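/- Let $d\ge 2$ and $k\ge 1$ be integers. Definitions. A set $P\subset\mathbb R^d$ is separated if $\|p-q\|\ge 1$ for all distinct $p,q\in P$. A separated set $P$ is an $\varepsilon$-nearly $k$-distance set if there are reals $1<t_1<\dots<t_k$ with $\|p-q\|\in\bigcup_{i=1}^k[t_i,t_i+\varepsilon]$ for all distinct $p,q\in P$. The angle between a nonzero vector $v$ and an affine subspace $\Lambda$ of positive dimension is the infimum of the angles between $v$ and the nonzero vectors of the direction space $\Lambda-\Lambda$. A set $P\subset\mathbb R^d$ is $(d-1,\alpha)$-flat if for every $p\in P$ there is a hyperplane $\Lambda_p$ such that the angle between $p-q$ and $\Lambda_p$ is at most $\alpha$ for every $q\in P\setminus\{p\}$. Let $N_k(d)$ be the largest $N$ such that for all $\varepsilon,\alpha>0$ there is a $(d-1,\alpha)$-flat $\varepsilon$-nearly $k$-distance set of cardinality $N$ in $\mathbb R^d$. For $L\ge 0$ let $M_k(d,n;L)$ be the largest $M$ for which there are a separated set $S\subset\mathbb R^d$ of $n$ points and reals $1\le t_1\le\dots\le t_k$ such that at least $M$ unordered pairs $\{p,q\}$ of distinct points of $S$ satisfy $\|p-q\|\in\bigcup_{i=1}^k[t_i,t_i+L]$,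 and put $M_k(d,n)=M_k(d,n;1)$. Let $T(n,s)$ be the number of edges of the balanced complete $s$-partite graph on $n$ vertices. Theorem. The maximum $N_k(d)$ exists (it is finite), and the following hold. (a) There is a constant $C=C(k,d)$ such that for every $n\ge 0$ $$M_k(d,n)\ \ge\ T\big(n,N_k(d)\big)\ \ge\ \Big(1-\frac1{N_k(d)}\Big)\frac{n^2}2-C .$$ (b) For every $\gamma>0$ there is $n_0$ such that for all $n\ge n_0$ $$\Big(1-\frac1{N_k(d)}-\gamma\Big)\frac{n^2}2\ \le\ M_k(d,n)\ \le\ \Big(1-\frac1{N_k(d)}+\gamma\Big)\frac{n^2}2 .$$ (c) For every $\gamma>0$ there are $c=c(k,d,\gamma)>0$ and $n_0$ such that for all $n\ge n_0$ the two inequalities of (b) hold with $M_k(d,n;\,c\,n^{1/d})$ in place of $M_k(d,n)$. -/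

import Mathlib

namespace NearlyDist

/-- A set of points is separated if distinct points are at distance at least `1`. -/
def Separated {d : ℕ} (P : Set (EuclideanSpace ℝ (Fin d))) : Prop :=
  P.Pairwise fun p q => 1 ≤ dist p q

/-- `P` is an `ε`-nearly `k`-distance set: it is separated and, for some reals
`1 < t₁ < ⋯ < t_k`, all distances between distinct points of `P` lie in the union of
the intervals `[t_i, t_i + ε]`. -/
def IsNearlyKDistance {d : ℕ} (k : ℕ) (ε : ℝ) (P : Set (EuclideanSpace ℝ (Fin d))) : Prop :=
  Separated P ∧ ∃ t : Fin k → ℝ, StrictMono t ∧ (∀ i, 1 < t i) ∧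
    P.Pairwise fun p q => ∃ i, dist p q ∈ Set.Icc (t i) (t i + ε)

/-- The angle between a vector `v` and a plane (affine subspace) `Λ`: the infimum of the angles
between `v` and the vectors of the direction space `Λ - Λ`. (Mathlib's angle with the zero vector
is `π / 2`, which does not influence the infimum as soon as `Λ` has dimension at least `1`.) -/
noncomputable def angleToPlane {d : ℕ} (v : EuclideanSpace ℝ (Fin d))
    (Λ : AffineSubspace ℝ (EuclideanSpace ℝ (Fin d))) : ℝ :=
  ⨅ w : Λ.direction, InnerProductGeometry.angle v (w : EuclideanSpace ℝ (Fin d))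

/-- `P` is `(j, α)`-flat: every `p ∈ P` has a `j`-dimensional plane `Λ` such that every vector
`p - q`, with `q ∈ P` different from `p`, makes an angle at most `α` with `Λ`. By convention
only sets with at most one point are `(0, α)`-flat. -/
def IsFlat {d : ℕ} (j : ℕ) (α : ℝ) (P : Set (EuclideanSpace ℝ (Fin d))) : Prop :=
  (j = 0 → P.Subsingleton) ∧
  ∀ p ∈ P, ∃ Λ : AffineSubspace ℝ (EuclideanSpace ℝ (Fin d)),
    (Λ : Set (EuclideanSpace ℝ (Fin d))).Nonempty ∧ Module.finrank ℝ Λ.direction = j ∧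
    ∀ q ∈ P, q ≠ p → angleToPlane (p - q) Λ ≤ α

/-- The set of all `N` such that for all `ε, α > 0` there is a `(j, α)`-flat `ε`-nearly
`k`-distance set of cardinality `N` in `ℝ^d`. -/
def flatCards (k d j : ℕ) : Set ℕ :=
  {N | ∀ ε : ℝ, 0 < ε → ∀ α : ℝ, 0 < α → ∃ P : Finset (EuclideanSpace ℝ (Fin d)),
    IsNearlyKDistance k ε (P : Set (EuclideanSpace ℝ (Fin d))) ∧
    IsFlat j α (P : Set (EuclideanSpace ℝ (Fin d))) ∧ P.card = N}

/-- `N_k(d)`: the largest element of `flatCards k d (d - 1)`. -/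
noncomputable def flatNumber (k d : ℕ) : ℕ := sSup (flatCards k d (d - 1))

/-- The graph on a finite point set `S` in which two distinct points are adjacent if their
distance lies in the union of the intervals `[t_i, t_i + L]`. -/
def distGraph {d k : ℕ} (S : Finset (EuclideanSpace ℝ (Fin d))) (t : Fin k → ℝ) (L : ℝ) :
    SimpleGraph S where
  Adj p q := p ≠ q ∧ ∃ i, dist (p : EuclideanSpace ℝ (Fin d)) q ∈ Set.Icc (t i) (t i + L)
  symm := ⟨fun p q h => ⟨h.1.symm, by simpa only [dist_comm] using h.2⟩⟩
  loopless := ⟨fun _ h => h.1 rfl⟩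

/-- All `M` for which there are a separated set `S` of `n` points in `ℝ^d` and reals
`1 ≤ t₁ ≤ ⋯ ≤ t_k` such that at least `M` (unordered) pairs of points of `S` have their distance
in the union of the intervals `[t_i, t_i + L]`. -/
def pairCounts (k d n : ℕ) (L : ℝ) : Set ℕ :=
  {M | ∃ (S : Finset (EuclideanSpace ℝ (Fin d))) (t : Fin k → ℝ),
    Separated (S : Set (EuclideanSpace ℝ (Fin d))) ∧ S.card = n ∧ Monotone t ∧ (∀ i, 1 ≤ t i) ∧
    M ≤ (distGraph S t L).edgeSet.ncard}

/-- `M_k(d, n)` for intervals of length `L`: the largest element of `pairCounts k d n L`. -/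
noncomputable def maxPairs (k d n : ℕ) (L : ℝ) : ℕ := sSup (pairCounts k d n L)

/-- The number `T(n, s)` of edges of the balanced complete `s`-partite graph on `n` vertices. -/
def turanNumber (n s : ℕ) : ℕ := (SimpleGraph.turanGraph n s).edgeFinset.card

/-- The maximum defining `maxPairs` is attained. -/
theorem isGreatest_maxPairs (k d n : ℕ) (hd : 1 ≤ d) (L : ℝ) :
    IsGreatest (pairCounts k d n L) (maxPairs k d n L) := by
  have hne : (pairCounts k d n L).Nonempty := by
    let f : ℕ → EuclideanSpace ℝ (Fin d) := fun m => PiLp.single 2 ⟨0, hd⟩ (m : ℝ)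
    have hf : ∀ a b : ℕ, a ≠ b → 1 ≤ dist (f a) (f b) := by
      intro a b hab
      have h : dist (f a) (f b) = dist a b := by
        rw [PiLp.dist_single_same]
        exact Nat.dist_cast_real a b
      rw [h]
      exact Nat.pairwise_one_le_dist hab
    have hinj : Function.Injective f := by
      intro a b h
      by_contra hab
      have := hf a b hab
      rw [h, dist_self] at this
      linarith
    classical
    refine ⟨0, (Finset.range n).image f, fun _ => 1, ?_, ?_, fun _ _ _ => le_rfl, fun _ => le_rfl,
      Nat.zero_le _⟩
    · intro p hp q hq hpq
      simp only [Finset.coe_image, Set.mem_image] at hp hq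
      obtain ⟨a, -, rfl⟩ := hp
      obtain ⟨b, -, rfl⟩ := hq
      exact hf a b fun h => hpq (by rw [h])
    · rw [Finset.card_image_of_injective _ hinj, Finset.card_range]
  have hbdd : BddAbove (pairCounts k d n L) := by
    refine ⟨n.choose 2, ?_⟩
    rintro M ⟨S, t, -, hS, -, -, hM⟩
    classical
    refine hM.trans ?_
    rw [← SimpleGraph.coe_edgeFinset, Set.ncard_coe_finset]
    simpa [hS] using (distGraph S t L).card_edgeFinset_le_card_choose_two
  exact ⟨Nat.sSup_mem hne hbdd, fun M hM => le_csSup hbdd hM⟩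

end NearlyDist

namespace NearlyDist
open Finset

/-! Write `N` for `flatNumber k d`. It is finite because of packing: among very many points,
Ramsey's theorem finds many whose mutual distances all lie in one interval `[t i, t i + 1]` with `t
i > 1`, and a volume count excludes this.

Lower bound: take an extremal flat set of `N` points, enlarge it by a huge factor `R`, and replace
each point by a row of unit-spaced points along the normal of its hyperplane. Flatness makes the
rows almost orthogonal to the differences of the enlarged points, so sliding along them hardly
changes the distances between rows. All pairs from different rows therefore count, and they form a
Turán graph (`turanNumber_mem_pairCounts`).

Upper bound: more pairs than claimed leave, after sampling, a fixed number of points that are far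
apart and still span a dense graph (`exists_far_dense_subset`). Erdős–Stone gives a blow-up of the
complete graph on `N + 1` vertices. After rescaling, its intervals are arbitrarily short while its
points stay separated. In each class two points are close relative to the distances to the other
classes; being nearly equidistant from any point there, they differ by a vector almost normal to the
directions towards it (`exists_flat_of_blowup`). One point per class then gives a flat set of `N +
1` points, against maximality. The argument tolerates intervals of length `c n^(1/d)`, the scale of
typical distances in a sample; length `1` follows by monotonicity. -/

/-! ### Ramsey theory -/

/-- Asymmetric multicolour Ramsey for pairs `a < b`. -/
theorem exists_monochromatic_of_pow_le {α κ : Type*} [LinearOrder α] [Fintype κ] [DecidableEq κ]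
    [Nonempty κ] (c : α → α → κ) (S : ℕ) :
    ∀ (s : κ → ℕ), ∑ i, s i = S → ∀ P : Finset α, (Fintype.card κ + 1) ^ S ≤ P.card →
      ∃ i, ∃ Q ⊆ P, Q.card = s i ∧ ∀ a ∈ Q, ∀ b ∈ Q, a < b → c a b = i := by
  induction S with
  | zero =>
    intro s hs P _
    obtain ⟨i⟩ := ‹Nonempty κ›
    refine ⟨i, ∅, by simp, ?_, by simp⟩
    have := (Finset.sum_eq_zero_iff.1 hs) i (mem_univ i)
    simp [this]
  | succ S ih =>
    intro s hs P hP
    by_cases h0 : ∃ i, s i = 0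
    · obtain ⟨i, hi⟩ := h0
      exact ⟨i, ∅, by simp, by simp [hi], by simp⟩
    push Not at h0
    have hPpos : 0 < P.card := lt_of_lt_of_le (by positivity) hP
    have hPne : P.Nonempty := card_pos.1 hPpos
    set p := P.min' hPne with hp
    have hpP : p ∈ P := P.min'_mem hPne
    have hlarge : Fintype.card κ * (Fintype.card κ + 1) ^ S ≤ (P.erase p).card := by
      rw [card_erase_of_mem hpP]
      have : 0 < (Fintype.card κ + 1) ^ S := by positivity
      rw [pow_succ, mul_add, mul_one, mul_comm] at hP
      omega
    -- Pigeonhole on the colours seen from the least element `p`: the target of the popular colour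
    -- `i` drops by one, and `p` is restored if the induction returns `i`.
    obtain ⟨i, -, hi⟩ := Finset.exists_le_card_fiber_of_mul_le_card_of_maps_to
      (s := P.erase p) (t := (univ : Finset κ)) (f := c p) (fun _ _ => mem_univ _)
      univ_nonempty (by simpa using hlarge)
    have hs' : ∑ j, Function.update s i (s i - 1) j = S := by
      have h1 := Finset.sum_update_of_mem (mem_univ i) s (s i - 1)
      have h2 := Finset.add_sum_erase univ s (mem_univ i)
      rw [Finset.sdiff_singleton_eq_erase] at h1
      have := h0 i
      omega
    obtain ⟨j, Q, hQ, hQc, hQm⟩ := ih _ hs' _ hi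
    have hQP : Q ⊆ P := fun x hx => mem_of_mem_erase (mem_of_mem_filter x (hQ hx))
    by_cases hji : j = i
    · subst hji
      have hpQ : p ∉ Q := fun h => by
        have := mem_of_mem_filter _ (hQ h)
        simp at this
      refine ⟨j, insert p Q, insert_subset hpP hQP, ?_, ?_⟩
      · rw [card_insert_of_notMem hpQ, hQc, Function.update_self]
        have := h0 j
        omega
      · intro a ha b hb hab
        rw [mem_insert] at ha hb
        have hmin : ∀ x ∈ Q, p ≤ x := fun x hx => P.min'_le x (hQP hx)
        rcases ha with rfl | ha
        · rcases hb with rfl | hb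
          · exact absurd hab (lt_irrefl _)
          · exact (mem_filter.1 (hQ hb)).2
        · rcases hb with rfl | hb
          · exact absurd hab (not_lt.2 (hmin a ha))
          · exact hQm a ha b hb hab
    · refine ⟨j, Q, hQP, ?_, hQm⟩
      rw [hQc, Function.update_of_ne hji]

theorem exists_ramsey (κ : Type*) [Finite κ] [Nonempty κ] (m : ℕ) :
    ∃ M : ℕ, ∀ c : Fin M → Fin M → κ, ∃ (g : Fin m ↪o Fin M) (i : κ),
      ∀ a b, a < b → c (g a) (g b) = i := by
  classical
  have := Fintype.ofFinite κ
  refine ⟨(Fintype.card κ + 1) ^ (∑ _i : κ, m), fun c => ?_⟩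
  obtain ⟨i, Q, -, hQ, h⟩ := exists_monochromatic_of_pow_le c _ (fun _ => m) rfl univ (by simp)
  exact ⟨Q.orderEmbOfFin hQ, i, fun a b hab => h _ (Q.orderEmbOfFin_mem hQ a) _
    (Q.orderEmbOfFin_mem hQ b) (by simpa using hab)⟩

/-- In a blow-up with large parts one finds large subparts such that the colour of a cross pair
depends only on the parts. -/
theorem exists_uniform_subparts (κ : Type*) [Finite κ] [Nonempty κ] (r m : ℕ) :
    ∃ M : ℕ, ∀ c : Fin r → Fin r → Fin M → Fin M → κ, ∃ (e : Fin r → Fin m → Fin M)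
      (F : Fin r → Fin r → κ), (∀ i, Function.Injective (e i)) ∧
        ∀ i j, i < j → ∀ x y, c i j (e i x) (e j y) = F i j := by
  -- One index pair is coloured by all its colours at once, over every pair of parts. Cutting the
  -- homogeneous index set into `r` consecutive blocks, one per part, makes all cross pairs
  -- increasing.
  obtain ⟨M, hM⟩ := exists_ramsey (Fin r → Fin r → κ) (r * m)
  refine ⟨M, fun c => ?_⟩
  obtain ⟨g, F, hg⟩ := hM fun a b i j => c i j a b
  refine ⟨fun i x => g (finProdFinEquiv (i, x)), F, fun i x y h => ?_, fun i j hij x y => ?_⟩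
  · simpa using h
  · have hlt : finProdFinEquiv (i, x) < finProdFinEquiv (j, y) := by
      rw [Fin.lt_def]
      simp only [finProdFinEquiv_apply_val]
      have h1 : (i : ℕ) + 1 ≤ j := hij
      have h2 := Nat.mul_le_mul_left m h1
      have := x.2
      rw [mul_add] at h2
      omega
    exact congrFun (congrFun (hg _ _ hlt) i) j

/-! ### Averaging and the Erdős–Stone theorem -/

theorem sum_erase_sum_erase {V : Type*} [DecidableEq V] (w : V → V → ℝ) (hw : ∀ p, w p p = 0)
    (S : Finset V) {v : V} (hv : v ∈ S) :
    ∑ p ∈ S.erase v, ∑ q ∈ S.erase v, w p q =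
      ∑ p ∈ S, ∑ q ∈ S, w p q - ∑ q ∈ S, w v q - ∑ p ∈ S, w p v := by
  have h1 : ∀ p, ∑ q ∈ S.erase v, w p q = ∑ q ∈ S, w p q - w p v := fun p => by
    rw [← Finset.add_sum_erase S _ hv]; ring
  simp_rw [h1, Finset.sum_sub_distrib]
  rw [← Finset.add_sum_erase S (fun p => ∑ q ∈ S, w p q) hv,
    ← Finset.add_sum_erase S (fun p => w p v) hv, hw]
  ring

/-- Some subset of every smaller cardinality has at least the average weight. -/
theorem exists_subset_sum_ge {V : Type*} [DecidableEq V] (w : V → V → ℝ) (hw : ∀ p, w p p = 0)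
    (c : ℝ) {m : ℕ} (hm : 1 ≤ m) (n : ℕ) (hmn : m ≤ n) :
    ∀ S : Finset V, S.card = n → c * (n * (n - 1)) ≤ ∑ p ∈ S, ∑ q ∈ S, w p q →
      ∃ W ⊆ S, W.card = m ∧ c * (m * (m - 1)) ≤ ∑ p ∈ W, ∑ q ∈ W, w p q := by
  induction n, hmn using Nat.le_induction with
  | base => exact fun S hS h => ⟨S, subset_rfl, hS, h⟩
  | succ n hn ih =>
    intro S hS h
    have hn1 : (1 : ℝ) ≤ n := by exact_mod_cast hm.trans hn
    have hSne : S.Nonempty := card_pos.1 (by omega)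
    set T := ∑ p ∈ S, ∑ q ∈ S, w p q with hT
    obtain ⟨v, hv, hvle⟩ : ∃ v ∈ S, c * (n * (n - 1)) ≤
        ∑ p ∈ S.erase v, ∑ q ∈ S.erase v, w p q := by
      apply Finset.exists_le_of_sum_le hSne
      -- Each ordered pair of distinct points survives `n - 1` of the `n + 1` deletions.
      have : ∑ v ∈ S, ∑ p ∈ S.erase v, ∑ q ∈ S.erase v, w p q = (n - 1) * T := by
        rw [Finset.sum_congr rfl fun v hv => sum_erase_sum_erase w hw S hv,
          Finset.sum_sub_distrib, Finset.sum_sub_distrib, Finset.sum_const, hS,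
          Finset.sum_comm (f := fun v p => w p v)]
        simp only [nsmul_eq_mul, ← hT]
        push_cast
        ring
      rw [this, Finset.sum_const, hS, nsmul_eq_mul]
      push_cast at h ⊢
      nlinarith [mul_le_mul_of_nonneg_left h (sub_nonneg.2 hn1)]
    obtain ⟨W, hW, hWm, hWs⟩ := ih (S.erase v) (by rw [card_erase_of_mem hv, hS]; rfl) hvle
    exact ⟨W, hW.trans (erase_subset _ _), hWm, hWs⟩

/-- **Erdős–Stone theorem** in its density version, for induced subgraphs. -/
theorem exists_blowup_of_density {γ : ℝ} (hγ : 0 < γ) (r t : ℕ) (hr : 1 ≤ r) :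
    ∃ n₀ : ℕ, ∀ (V : Type) (G : SimpleGraph V) [DecidableRel G.Adj] (W : Finset V),
      n₀ ≤ W.card →
      (1 - 1 / (r : ℝ) + γ) * (W.card : ℝ) ^ 2 ≤ ∑ p ∈ W, ∑ q ∈ W, (if G.Adj p q then 1 else 0) →
      ∃ f : Fin (r + 1) × Fin t → V, Function.Injective f ∧ (∀ x, f x ∈ W) ∧
        ∀ x y, x.1 ≠ y.1 → G.Adj (f x) (f y) := by
  obtain ⟨n₁, hn₁⟩ := Filter.eventually_atTop.1
    (SimpleGraph.eventually_completeEquipartiteGraph_isContained_of_minDegree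
      (half_pos hγ) r t)
  have hr' : (1 : ℝ) ≤ r := by exact_mod_cast hr
  set c : ℝ := 1 - 1 / (r : ℝ) + γ / 2 with hc
  have hc0 : 0 < c := by
    have : 1 / (r : ℝ) ≤ 1 := by rw [div_le_one (by positivity)]; exact hr'
    linarith
  -- `n₀` is such that `(γ / 2) n² - c n > (n₁ + 1)²` for `n ≥ n₀`
  obtain ⟨n₀, hn₀⟩ := exists_nat_gt (2 / γ * (c + (n₁ + 1) ^ 2) + 1)
  refine ⟨n₀, fun V G _ W hW hdens => ?_⟩
  classical
  let a : V → V → ℝ := fun p q => if G.Adj p q then 1 else 0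
  have ha0 : ∀ p, a p p = 0 := fun p => by simp [a]
  -- For a maximiser `U` of `Φ`, deleting `u` removes twice its degree and refunds `2 * c * U.card`,
  -- so every degree in `U` is at least `c * U.card`. Since `Φ U ≤ U.card ^ 2` while `Φ W` is large,
  -- `U` is also large.
  let Φ : Finset V → ℝ := fun U => ∑ p ∈ U, ∑ q ∈ U, a p q - c * (U.card * (U.card + 1))
  obtain ⟨U, hU, hmax⟩ := Finset.exists_max_image W.powerset Φ ⟨W, by simp⟩
  rw [mem_powerset] at hU
  have hbig : (n₁ : ℝ) < U.card := by
    have hΦ := hmax W (by simp)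
    have hle : ∑ p ∈ U, ∑ q ∈ U, a p q ≤ (U.card : ℝ) ^ 2 := by
      calc _ ≤ ∑ p ∈ U, ∑ q ∈ U, (1 : ℝ) := by
            gcongr with p _ q _
            simp only [a]; split_ifs <;> norm_num
        _ = _ := by simp [sq]
    have hΦW : (γ / 2) * (W.card : ℝ) ^ 2 - c * W.card ≤ Φ W := by
      simp only [Φ, a]
      have : (1 - 1 / (r : ℝ) + γ) = c + γ / 2 := by rw [hc]; ring
      rw [this] at hdens
      nlinarith
    have hWn : (n₀ : ℝ) ≤ W.card := by exact_mod_cast hW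
    have h1 : 2 / γ * (c + (n₁ + 1) ^ 2) + 1 < W.card := hn₀.trans_le hWn
    have h2 : c + ((n₁ : ℝ) + 1) ^ 2 < γ / 2 * W.card := by
      have : 2 / γ * (c + ((n₁ : ℝ) + 1) ^ 2) < W.card := by linarith
      rw [div_mul_eq_mul_div, div_lt_iff₀ hγ] at this
      linarith
    have hW1 : (1 : ℝ) ≤ W.card := by
      have : 0 ≤ 2 / γ * (c + ((n₁ : ℝ) + 1) ^ 2) := by positivity
      linarith
    have h3 : ((n₁ : ℝ) + 1) ^ 2 ≤ (γ / 2) * (W.card : ℝ) ^ 2 - c * W.card := by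
      have h4 : ((n₁ : ℝ) + 1) ^ 2 ≤ γ / 2 * W.card - c := by linarith
      nlinarith [sq_nonneg ((n₁ : ℝ) + 1)]
    have h5 : ((n₁ : ℝ) + 1) ^ 2 ≤ (U.card : ℝ) ^ 2 := by
      have : 0 ≤ c * ((U.card : ℝ) * (U.card + 1)) := by positivity
      have : Φ U ≤ (U.card : ℝ) ^ 2 := by simp only [Φ]; linarith
      linarith
    have := abs_le_of_sq_le_sq' h5 (by positivity)
    linarith [this.2]
  have hdeg : ∀ u ∈ U, c * U.card ≤ ∑ q ∈ U, a u q := by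
    intro u hu
    by_contra! hlt
    have h1 := hmax (U.erase u) (mem_powerset.2 ((erase_subset _ _).trans hU))
    have hsymm : ∑ p ∈ U, a p u = ∑ q ∈ U, a u q :=
      Finset.sum_congr rfl fun p _ => by simp only [a, G.adj_comm]
    simp only [Φ] at h1
    rw [sum_erase_sum_erase a ha0 U hu, hsymm, cast_card_erase_of_mem hu] at h1
    nlinarith
  let φ : Fin U.card ↪ V := (U.equivFin.symm.toEmbedding).trans (Function.Embedding.subtype _)
  have hφU : ∀ i, φ i ∈ U := fun i => (U.equivFin.symm i).2
  have hsum : ∀ F : V → ℝ, ∑ i, F (φ i) = ∑ q ∈ U, F q := fun F => by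
    rw [← Finset.sum_coe_sort U]
    exact Equiv.sum_comp U.equivFin.symm (fun q : U => F q)
  have hUpos : 0 < U.card := by
    have : (0 : ℝ) ≤ n₁ := by positivity
    exact_mod_cast this.trans_lt hbig
  have : Nonempty (Fin U.card) := ⟨⟨0, hUpos⟩⟩
  obtain ⟨f⟩ := hn₁ U.card (by exact_mod_cast hbig.le) (G := G.comap φ) (by
    obtain ⟨v, hv⟩ := (G.comap φ).exists_minimal_degree_vertex
    rw [hv]
    have h1 := hdeg (φ v) (hφU v)
    rw [← hsum] at h1
    refine h1.trans_eq ?_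
    simp only [a]
    rw [Finset.sum_boole, ← SimpleGraph.card_neighborFinset_eq_degree,
      SimpleGraph.neighborFinset_eq_filter]
    simp)
  refine ⟨fun x => φ (f x), φ.injective.comp f.injective, fun x => hU (hφU _), fun x y hxy => ?_⟩
  exact f.toHom.map_adj (show (SimpleGraph.completeEquipartiteGraph (r + 1) t).Adj x y from by
    simpa using hxy)

/-! ### Packing, and angles with hyperplanes -/

-- Volume comparison: the balls of radius `r / 2` around the points are disjoint and lie in the ball
-- of radius `R + r / 2`.
open MeasureTheory Metric Module in
theorem card_le_of_separated_of_subset_closedBall {E : Type*} [NormedAddCommGroup E]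
    [NormedSpace ℝ E] [FiniteDimensional ℝ E] (s : Finset E) (c : E) {r R : ℝ} (hr : 0 < r)
    (hR : 0 ≤ R) (hs : ∀ x ∈ s, dist x c ≤ R) (h : ∀ x ∈ s, ∀ y ∈ s, x ≠ y → r ≤ dist x y) :
    (s.card : ℝ) ≤ (1 + 2 * R / r) ^ finrank ℝ E := by
  borelize E
  let μ : Measure E := Measure.addHaar
  have hδ : 0 < r / 2 := by positivity
  have hρ : 0 < R + r / 2 := by positivity
  have hdisj : Set.Pairwise (s : Set E) (Function.onFun Disjoint fun x => ball x (r / 2)) := by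
    rintro x hx y hy hxy
    apply ball_disjoint_ball
    have := h x hx y hy hxy
    linarith
  have hsub : (⋃ x ∈ s, ball x (r / 2)) ⊆ ball c (R + r / 2) := by
    refine Set.iUnion₂_subset fun x hx => ball_subset_ball' ?_
    linarith [hs x hx]
  have I : (s.card : ENNReal) * ENNReal.ofReal ((r / 2) ^ finrank ℝ E) * μ (ball 0 1) ≤
      ENNReal.ofReal ((R + r / 2) ^ finrank ℝ E) * μ (ball 0 1) :=
    calc
      _ = μ (⋃ x ∈ s, ball x (r / 2)) := by
        rw [measure_biUnion_finset hdisj fun c _ => measurableSet_ball]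
        simp only [μ.addHaar_ball_of_pos _ hδ]
        simp only [Finset.sum_const, nsmul_eq_mul, mul_assoc]
      _ ≤ μ (ball c (R + r / 2)) := measure_mono hsub
      _ = _ := by simp only [μ.addHaar_ball_of_pos _ hρ]
  have J := (ENNReal.mul_le_mul_iff_left (measure_ball_pos μ 0 zero_lt_one).ne'
    measure_ball_lt_top.ne).1 I
  have K := ENNReal.toReal_le_of_le_ofReal (by positivity) J
  rw [ENNReal.toReal_mul, ENNReal.toReal_natCast, ENNReal.toReal_ofReal (by positivity),
    ← le_div_iff₀ (by positivity), ← div_pow] at K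
  have hrw : 1 + 2 * R / r = (R + r / 2) / (r / 2) := by
    field_simp
    ring
  rwa [hrw]

/-- A vector almost orthogonal to `u` makes a small angle with the hyperplane `uᗮ`. -/
theorem angleToPlane_le {d : ℕ} {v u : EuclideanSpace ℝ (Fin d)} {α : ℝ} (hα : 0 < α)
    (hα1 : α ≤ 1) (hv : v ≠ 0) (hu : u ≠ 0)
    (h : |inner ℝ v u| ≤ Real.sin α * (‖v‖ * ‖u‖))
    (Λ : AffineSubspace ℝ (EuclideanSpace ℝ (Fin d)))
    (hΛ : ∀ w, inner ℝ w u = 0 → w ∈ Λ.direction) : angleToPlane v Λ ≤ α := by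
  have hunorm : 0 < ‖u‖ := norm_pos_iff.2 hu
  have hπ := Real.pi_gt_three
  have hcos : 0 < Real.cos α := Real.cos_pos_of_mem_Ioo ⟨by linarith, by linarith⟩
  set w : EuclideanSpace ℝ (Fin d) := v - (inner ℝ v u / ‖u‖ ^ 2) • u with hw
  have hwu : inner ℝ w u = 0 := by
    rw [hw, inner_sub_left, real_inner_smul_left, real_inner_self_eq_norm_sq]
    field_simp
    ring
  have hbdd : BddBelow (Set.range fun w : Λ.direction =>
      InnerProductGeometry.angle v (w : EuclideanSpace ℝ (Fin d))) :=
    ⟨0, by rintro _ ⟨w, rfl⟩; exact InnerProductGeometry.angle_nonneg _ _⟩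
  refine (ciInf_le hbdd ⟨w, hΛ w hwu⟩).trans ?_
  have hvnorm : 0 < ‖v‖ := norm_pos_iff.2 hv
  have hvw : inner ℝ v w = ‖w‖ ^ 2 := by
    have : v = w + (inner ℝ v u / ‖u‖ ^ 2) • u := by rw [hw]; abel
    conv_lhs => rw [this]
    rw [inner_add_left, real_inner_smul_left, real_inner_comm w u, hwu, real_inner_self_eq_norm_sq]
    ring
  have hwsq : ‖w‖ ^ 2 = ‖v‖ ^ 2 - inner ℝ v u ^ 2 / ‖u‖ ^ 2 := by
    rw [← hvw, hw, inner_sub_right, real_inner_smul_right, real_inner_self_eq_norm_sq]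
    ring
  have hge : (Real.cos α * ‖v‖) ^ 2 ≤ ‖w‖ ^ 2 := by
    have h2 : inner ℝ v u ^ 2 / ‖u‖ ^ 2 ≤ (Real.sin α * ‖v‖) ^ 2 := by
      rw [div_le_iff₀ (by positivity), ← mul_pow]
      apply sq_le_sq'
      · have := (abs_le.1 h).1; linarith
      · have := (abs_le.1 h).2; linarith
    have := Real.sin_sq_add_cos_sq α
    rw [hwsq]
    nlinarith
  have hge' : Real.cos α * ‖v‖ ≤ ‖w‖ := by
    have := abs_le_of_sq_le_sq' hge (norm_nonneg w)
    exact this.2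
  have hwpos : 0 < ‖w‖ := lt_of_lt_of_le (by positivity) hge'
  change Real.arccos (inner ℝ v w / (‖v‖ * ‖w‖)) ≤ α
  rw [← Real.arccos_cos hα.le (by linarith), hvw]
  apply Real.arccos_le_arccos
  rw [le_div_iff₀ (by positivity)]
  nlinarith

/-- A partial converse of `angleToPlane_le`. The factor `2` buys a direction `w` at angle strictly
below `2 * α` without attaining the infimum; `α ≤ 1 / 2` rules out `w = 0`, whose angle is `π / 2`.
-/
theorem abs_inner_le_of_angleToPlane_le {d : ℕ} {v u : EuclideanSpace ℝ (Fin d)} {α : ℝ}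
    (hα : 0 < α) (hα1 : α ≤ 1 / 2) (hu : ‖u‖ = 1)
    (Λ : AffineSubspace ℝ (EuclideanSpace ℝ (Fin d)))
    (hΛ : ∀ w ∈ Λ.direction, inner ℝ w u = 0) (h : angleToPlane v Λ ≤ α) :
    |inner ℝ v u| ≤ 2 * α * ‖v‖ := by
  obtain ⟨⟨w, hwΛ⟩, hw⟩ := exists_lt_of_ciInf_lt (lt_of_le_of_lt h (by linarith : α < 2 * α))
  simp only at hw
  have hπ := Real.pi_gt_three
  have hw0 : w ≠ 0 := by
    rintro rfl
    rw [InnerProductGeometry.angle_zero_right] at hw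
    linarith
  have hwnorm : 0 < ‖w‖ := norm_pos_iff.2 hw0
  have hwu := hΛ w hwΛ
  set θ := InnerProductGeometry.angle v w with hθ
  have hθ0 : 0 ≤ θ := InnerProductGeometry.angle_nonneg _ _
  have hcos : Real.cos θ * (‖v‖ * ‖w‖) = inner ℝ v w := InnerProductGeometry.cos_angle_mul_norm_mul_norm v w
  -- Bessel's inequality for the orthogonal vectors `u`, `w`
  have hbessel : inner ℝ v u ^ 2 + (Real.cos θ * ‖v‖) ^ 2 ≤ ‖v‖ ^ 2 := by
    set e : EuclideanSpace ℝ (Fin d) := ‖w‖⁻¹ • w with he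
    have hen : inner ℝ e e = 1 := by
      rw [he, real_inner_smul_left, real_inner_smul_right, real_inner_self_eq_norm_sq]
      field_simp
    have hun : inner ℝ u u = 1 := by rw [real_inner_self_eq_norm_sq, hu, one_pow]
    have heu : inner ℝ e u = 0 := by rw [he, real_inner_smul_left, hwu, mul_zero]
    have hue : inner ℝ u e = 0 := by rw [real_inner_comm, heu]
    have hve : inner ℝ v e = Real.cos θ * ‖v‖ := by
      rw [he, real_inner_smul_right, ← hcos]
      field_simp
    have hev : inner ℝ e v = Real.cos θ * ‖v‖ := by rw [real_inner_comm, hve]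
    have huv : inner ℝ u v = inner ℝ v u := real_inner_comm _ _
    have hvv : inner ℝ v v = ‖v‖ ^ 2 := real_inner_self_eq_norm_sq v
    have h2 := real_inner_self_nonneg (x := v - (inner ℝ v u : ℝ) • u - (Real.cos θ * ‖v‖) • e)
    simp only [inner_sub_left, inner_sub_right, real_inner_smul_left, real_inner_smul_right,
      hen, hun, heu, hue, hve, hev, huv, hvv] at h2
    nlinarith
  have hsin : Real.sin θ ≤ 2 * α := (Real.sin_le hθ0).trans hw.le
  have hsin0 : 0 ≤ Real.sin θ := InnerProductGeometry.sin_angle_nonneg _ _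
  have : inner ℝ v u ^ 2 ≤ (2 * α * ‖v‖) ^ 2 := by
    have h1 := Real.sin_sq_add_cos_sq θ
    have h2 : inner ℝ v u ^ 2 ≤ (Real.sin θ * ‖v‖) ^ 2 := by nlinarith
    refine h2.trans ?_
    gcongr
  exact abs_le_of_sq_le_sq this (by positivity)

theorem exists_unit_normal {d : ℕ} (hd : 1 ≤ d)
    (Λ : AffineSubspace ℝ (EuclideanSpace ℝ (Fin d))) (hΛ : Module.finrank ℝ Λ.direction = d - 1) :
    ∃ u : EuclideanSpace ℝ (Fin d), ‖u‖ = 1 ∧ ∀ w ∈ Λ.direction, inner ℝ w u = 0 := by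
  have h1 := Λ.direction.finrank_add_finrank_orthogonal
  rw [hΛ, finrank_euclideanSpace_fin] at h1
  have : Nontrivial Λ.directionᗮ := Module.nontrivial_of_finrank_pos (R := ℝ) (by omega)
  obtain ⟨u, hu⟩ := exists_norm_eq (Λ.directionᗮ) (zero_le_one (α := ℝ))
  exact ⟨u, hu, fun w hw => (Submodule.mem_orthogonal _ _).1 u.2 w hw⟩

theorem exists_hyperplane {d : ℕ} {u : EuclideanSpace ℝ (Fin d)} (hu : u ≠ 0) :
    ∃ Λ : AffineSubspace ℝ (EuclideanSpace ℝ (Fin d)),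
      (Λ : Set (EuclideanSpace ℝ (Fin d))).Nonempty ∧ Module.finrank ℝ Λ.direction = d - 1 ∧
      ∀ w, inner ℝ w u = 0 → w ∈ Λ.direction := by
  refine ⟨AffineSubspace.mk' 0 (ℝ ∙ u)ᗮ, AffineSubspace.mk'_nonempty _ _, ?_, fun w hw => ?_⟩
  · rw [AffineSubspace.direction_mk']
    have h1 := (ℝ ∙ u).finrank_add_finrank_orthogonal
    rw [finrank_span_singleton hu, finrank_euclideanSpace_fin] at h1
    omega
  · rw [AffineSubspace.direction_mk', Submodule.mem_orthogonal_singleton_iff_inner_left]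
    exact hw

/-! ### Existence of the maximal flat cardinality -/

/-- Finitely many reals `> 1` can be completed to a strictly increasing family. -/
theorem exists_strictMono_of_card_le {k : ℕ} (T : Finset ℝ) (hT : T.card ≤ k) (h1 : ∀ x ∈ T, 1 < x) :
    ∃ τ : Fin k → ℝ, StrictMono τ ∧ (∀ i, 1 < τ i) ∧ ∀ x ∈ T, ∃ i, τ i = x := by
  have : ∃ T' : Finset ℝ, T ⊆ T' ∧ T'.card = k ∧ ∀ x ∈ T', 1 < x := by
    induction k, hT using Nat.le_induction with
    | base => exact ⟨T, subset_rfl, rfl, h1⟩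
    | succ k _ ih =>
      obtain ⟨T', hTT', hk, h⟩ := ih
      obtain ⟨x, hx, hxT⟩ := (Set.Ioi_infinite (1 : ℝ)).exists_notMem_finset T'
      refine ⟨insert x T', hTT'.trans (subset_insert _ _), ?_, ?_⟩
      · rw [card_insert_of_notMem hxT, hk]
      · intro y hy
        rcases mem_insert.1 hy with rfl | hy
        · exact hx
        · exact h y hy
  obtain ⟨T', hTT', hk, h⟩ := this
  refine ⟨T'.orderEmbOfFin hk, (T'.orderEmbOfFin hk).strictMono,
    fun i => h _ (T'.orderEmbOfFin_mem hk i), fun x hx => ?_⟩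
  have : x ∈ Set.range (T'.orderEmbOfFin hk) := by
    rw [Finset.range_orderEmbOfFin]; exact hTT' hx
  exact this

/-- Ramsey reduces to points with all distances in one `[t i, t i + 1]`. As `t i > 1`, they are `t
i`-separated within a ball of radius `2 * t i`, so there are at most `5 ^ d`. -/
theorem exists_card_bound (k d : ℕ) (hk : 1 ≤ k) : ∃ B : ℕ,
    ∀ P : Finset (EuclideanSpace ℝ (Fin d)), IsNearlyKDistance k 1 (P : Set (EuclideanSpace ℝ (Fin d))) → P.card ≤ B := by
  have : Nonempty (Fin k) := ⟨⟨0, hk⟩⟩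
  obtain ⟨M, hM⟩ := exists_ramsey (Fin k) (5 ^ d + 2)
  refine ⟨M, fun P ⟨_, t, _, ht1, ht⟩ => ?_⟩
  by_contra! hlt
  let x : Fin M → EuclideanSpace ℝ (Fin d) := fun i => P.equivFin.symm (Fin.castLE hlt.le i)
  have hx : Function.Injective x := Subtype.val_injective.comp
    (P.equivFin.symm.injective.comp (Fin.castLE_injective hlt.le))
  have hxP : ∀ i, x i ∈ P := fun i => (P.equivFin.symm (Fin.castLE hlt.le i)).2
  have hcol : ∀ a b : Fin M, ∃ i, a ≠ b → dist (x a) (x b) ∈ Set.Icc (t i) (t i + 1) := by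
    intro a b
    by_cases hab : a = b
    · exact ⟨‹Nonempty (Fin k)›.some, fun h => absurd hab h⟩
    · obtain ⟨i, hi⟩ := ht (hxP a) (hxP b) fun h => hab (hx h)
      exact ⟨i, fun _ => hi⟩
  choose col hcol using hcol
  obtain ⟨g, i, hg⟩ := hM col
  have hdist : ∀ a b, a ≠ b → dist (x (g a)) (x (g b)) ∈ Set.Icc (t i) (t i + 1) := by
    intro a b hab
    rcases lt_or_gt_of_ne hab with h | h
    · rw [← hg a b h]
      exact hcol _ _ fun h' => hab (g.injective h')
    · rw [dist_comm, ← hg b a h]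
      exact hcol _ _ fun h' => hab (g.injective h').symm
  have hti := ht1 i
  have hinj : Function.Injective fun a => x (g a) := hx.comp g.injective
  classical
  have hcard := card_le_of_separated_of_subset_closedBall (univ.image fun a => x (g a))
    (x (g 0)) (r := t i) (R := 2 * t i) (by linarith) (by linarith) ?_ ?_
  · rw [card_image_of_injective _ hinj, card_univ, Fintype.card_fin, finrank_euclideanSpace_fin]
      at hcard
    have h5 : 1 + 2 * (2 * t i) / t i = 5 := by
      have : t i ≠ 0 := by linarith
      field_simp
      norm_num
    rw [h5] at hcard
    have : 5 ^ d + 2 ≤ 5 ^ d := by exact_mod_cast hcard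
    omega
  · intro y hy
    obtain ⟨a, -, rfl⟩ := mem_image.1 hy
    by_cases ha : a = 0
    · simp only [ha, dist_self]
      linarith
    · linarith [(hdist a 0 ha).2]
  · intro y hy z hz hyz
    obtain ⟨a, -, rfl⟩ := mem_image.1 hy
    obtain ⟨b, -, rfl⟩ := mem_image.1 hz
    exact (hdist a b fun h => hyz (by rw [h])).1

theorem bddAbove_flatCards (k d j : ℕ) (hk : 1 ≤ k) : BddAbove (flatCards k d j) := by
  obtain ⟨B, hB⟩ := exists_card_bound k d hk
  refine ⟨B, fun N hN => ?_⟩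
  obtain ⟨P, hP, -, rfl⟩ := hN 1 one_pos 1 one_pos
  exact hB P hP

theorem one_mem_flatCards (k d : ℕ) (hd : 2 ≤ d) : 1 ∈ flatCards k d (d - 1) := by
  intro ε _ α _
  refine ⟨{0}, ⟨by simp [Separated], fun i => (i : ℕ) + 2, ?_, ?_, by simp⟩, ⟨by simp, ?_⟩, rfl⟩
  · intro a b hab
    simpa using hab
  · intro i
    have : (0 : ℝ) ≤ (i : ℕ) := by positivity
    linarith
  · intro p hp
    have hu : (EuclideanSpace.single ⟨0, by omega⟩ 1 : EuclideanSpace ℝ (Fin d)) ≠ 0 := by simp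
    obtain ⟨Λ, hne, hdim, -⟩ := exists_hyperplane hu
    refine ⟨Λ, hne, hdim, fun q hq hqp => absurd ?_ hqp⟩
    simp only [coe_singleton, Set.mem_singleton_iff] at hp hq
    rw [hp, hq]

theorem isGreatest_flatNumber (k d : ℕ) (hd : 2 ≤ d) (hk : 1 ≤ k) :
    IsGreatest (flatCards k d (d - 1)) (flatNumber k d) :=
  ⟨Nat.sSup_mem ⟨1, one_mem_flatCards k d hd⟩ (bddAbove_flatCards k d _ hk),
    fun _ hN => le_csSup (bddAbove_flatCards k d _ hk) hN⟩

/-! ### From blow-ups to flat sets -/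

/-- If `p` and `p'` are at nearly the same distance from `q`, then `p' - p` is almost orthogonal
to `p - q`, provided `|p' - p|` is neither too small nor too large. -/
theorem abs_inner_le_of_dist_near {E : Type*} [NormedAddCommGroup E] [InnerProductSpace ℝ E]
    {p p' q : E} {s ε : ℝ} (hε : ε ≤ s / 2) (hε1 : ε ≤ 1) (hpp : 2 ≤ dist p' p)
    (hpp' : dist p' p ≤ s * dist p q) (hpq : 1 ≤ dist p q)
    (h : |dist p' q - dist p q| ≤ ε) :
    |inner ℝ (p - q) (p' - p)| ≤ s * (‖p - q‖ * ‖p' - p‖) := by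
  rw [dist_eq_norm, dist_eq_norm] at *
  have h1 : ‖p' - q‖ ^ 2 = ‖p - q‖ ^ 2 + 2 * inner ℝ (p - q) (p' - p) + ‖p' - p‖ ^ 2 := by
    rw [← norm_add_sq_real]
    congr 2
    abel
  have hε0 : 0 ≤ ε := (abs_nonneg _).trans h
  obtain ⟨h2, h3⟩ := abs_le.1 h
  set D := ‖p - q‖
  set D' := ‖p' - q‖
  set δ := ‖p' - p‖
  have hD' : 0 ≤ D' := norm_nonneg _
  have h4 : |D' ^ 2 - D ^ 2| ≤ ε * (3 * D) := by
    have : D' ^ 2 - D ^ 2 = (D' - D) * (D' + D) := by ring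
    rw [this, abs_mul, abs_of_nonneg (by linarith : 0 ≤ D' + D)]
    gcongr
    linarith
  obtain ⟨h5, h6⟩ := abs_le.1 h4
  -- By the cosine law, twice the inner product is `D' ^ 2 - D ^ 2 - δ ^ 2`. Here `δ ≥ 2` turns the
  -- first error, of order `ε * D`, into a multiple of `D * δ`; `δ ≤ s * D` controls the second.
  have h7 : ε * (3 * D) ≤ s / 2 * (3 / 2 * (D * δ)) := by
    have : ε * (3 * D) ≤ s / 2 * (3 * D) := by gcongr
    have h8 : 2 * D ≤ D * δ := by nlinarith
    have : s / 2 * (3 * D) ≤ s / 2 * (3 / 2 * (D * δ)) := by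
      apply mul_le_mul_of_nonneg_left _ (by linarith)
      linarith
    linarith
  have h9 : δ ^ 2 ≤ s * (D * δ) := by nlinarith
  have h10 : 0 ≤ s * (D * δ) := by
    have : 0 ≤ s := by linarith
    positivity
  rw [abs_le]
  constructor <;> nlinarith

theorem exists_uniform_blowup {X : Type*} [PseudoMetricSpace X] (k r m : ℕ) (hk : 1 ≤ k) :
    ∃ M : ℕ, ∀ (ε : ℝ) (t : Fin k → ℝ) (f : Fin r × Fin M → X),
      (∀ x y, x.1 ≠ y.1 → ∃ l, dist (f x) (f y) ∈ Set.Icc (t l) (t l + ε)) →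
      ∃ (e : Fin r → Fin m → Fin M) (F : Fin r → Fin r → Fin k),
        (∀ i, Function.Injective (e i)) ∧ ∀ i j, i ≠ j → ∀ x y,
          dist (f (i, e i x)) (f (j, e j y)) ∈ Set.Icc (t (F i j)) (t (F i j) + ε) := by
  have : Nonempty (Fin k) := ⟨⟨0, hk⟩⟩
  obtain ⟨M, hM⟩ := exists_uniform_subparts (Fin k) r m
  refine ⟨M, fun ε t f hf => ?_⟩
  have hcol : ∀ (i j : Fin r) (a b : Fin M),
      ∃ l, i ≠ j → dist (f (i, a)) (f (j, b)) ∈ Set.Icc (t l) (t l + ε) := by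
    intro i j a b
    by_cases hij : i = j
    · exact ⟨‹Nonempty (Fin k)›.some, fun h => absurd hij h⟩
    · obtain ⟨l, hl⟩ := hf (i, a) (j, b) hij
      exact ⟨l, fun _ => hl⟩
  choose col hcol using hcol
  obtain ⟨e, F, he, hF⟩ := hM col
  refine ⟨e, fun i j => if i < j then F i j else F j i, he, fun i j hij x y => ?_⟩
  beta_reduce
  rcases lt_or_gt_of_ne hij with h | h
  · rw [if_pos h, ← hF i j h x y]
    exact hcol _ _ _ _ hij
  · rw [if_neg h.not_gt, ← hF j i h y x, dist_comm]
    exact hcol _ _ _ _ hij.symm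

/-- A large blow-up of a clique in the graph of nearly equal distances contains a flat nearly
`k`-distance set with one point in each part. -/
theorem exists_flat_of_blowup (k d N : ℕ) (hk : 1 ≤ k) (hd : 2 ≤ d) (hN : 1 ≤ N) {ε α : ℝ}
    (hε : 0 < ε) (hα : 0 < α) :
    ∃ M : ℕ, ∃ ε' : ℝ, 0 < ε' ∧ ∀ (t : Fin k → ℝ)
      (f : Fin (N + 1) × Fin M → EuclideanSpace ℝ (Fin d)),
      (∀ x y, x ≠ y → 2 ≤ dist (f x) (f y)) →
      (∀ x y, x.1 ≠ y.1 → ∃ l, dist (f x) (f y) ∈ Set.Icc (t l) (t l + ε')) →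
      ∃ P : Finset (EuclideanSpace ℝ (Fin d)), IsNearlyKDistance k ε (P : Set (EuclideanSpace ℝ (Fin d))) ∧
        IsFlat (d - 1) α (P : Set (EuclideanSpace ℝ (Fin d))) ∧ P.card = N + 1 := by
  classical
  set β := min α 1 with hβ
  have hβ0 : 0 < β := lt_min hα one_pos
  have hβ1 : β ≤ 1 := min_le_right _ _
  set s := Real.sin β with hs
  have hs0 : 0 < s := Real.sin_pos_of_pos_of_lt_pi hβ0 (by linarith [Real.pi_gt_three])
  -- One more than the packing bound for `s * T`-separated points in a ball of radius `2 * T`, which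
  -- does not depend on `T`.
  set m := ⌊(1 + 4 / s) ^ d⌋₊ + 1 with hm
  obtain ⟨M, hM⟩ := exists_uniform_blowup (X := EuclideanSpace ℝ (Fin d)) k (N + 1) m hk
  refine ⟨M, min ε (min (1 / 2) (s / 2)), by positivity, fun t f hsep hdist => ?_⟩
  set ε' := min ε (min (1 / 2) (s / 2)) with hε'
  have hε'ε : ε' ≤ ε := min_le_left _ _
  have hε'1 : ε' ≤ 1 / 2 := (min_le_right _ _).trans (min_le_left _ _)
  have hε's : ε' ≤ s / 2 := (min_le_right _ _).trans (min_le_right _ _)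
  obtain ⟨e, F, he, hF⟩ := hM ε' t f hdist
  set V : Fin (N + 1) → Fin m → EuclideanSpace ℝ (Fin d) := fun i x => f (i, e i x) with hV
  have hVsep : ∀ i x y, x ≠ y → 2 ≤ dist (V i x) (V i y) := fun i x y hxy =>
    hsep _ _ fun h => hxy (he i (Prod.ext_iff.1 h).2)
  have hVsep' : ∀ i j x y, i ≠ j → 2 ≤ dist (V i x) (V j y) := fun i j x y hij =>
    hsep _ _ fun h => hij (Prod.ext_iff.1 h).1
  let o : Fin m := ⟨0, by omega⟩
  have hl : ∀ i j, i ≠ j → 3 / 2 ≤ t (F i j) := by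
    intro i j hij
    have h1 := hVsep' i j o o hij
    have h2 := (hF i j hij o o).2
    change dist (V i o) (V j o) ≤ _ at h2
    linarith
  -- in each part, two points that are close compared to the distances to the other parts
  have hpair : ∀ i, ∃ x y, x ≠ y ∧ ∀ j, j ≠ i → dist (V i y) (V i x) ≤ s * t (F i j) := by
    intro i
    have hne : (univ.erase i).Nonempty := by
      rw [← card_pos, card_erase_of_mem (mem_univ i), card_univ, Fintype.card_fin]
      omega
    -- Part `i` lies in a ball of radius `2 * t (F i j)` for the nearest other part `j`, so packing
    -- yields a pair closer than `s * t (F i j)`; minimality makes it close relative to every part.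
    obtain ⟨j, hj, hmin⟩ := exists_min_image (univ.erase i) (fun j => t (F i j)) hne
    have hji : j ≠ i := ne_of_mem_erase hj
    have hlj := hl i j hji.symm
    by_contra! hcon
    have hfar : ∀ x y, x ≠ y → s * t (F i j) ≤ dist (V i x) (V i y) := by
      intro x y hxy
      obtain ⟨j', hj', hlt⟩ := hcon y x hxy.symm
      refine le_trans ?_ hlt.le
      exact mul_le_mul_of_nonneg_left (hmin j' (mem_erase.2 ⟨hj', mem_univ _⟩)) hs0.le
    have hinj : Function.Injective (V i) := by
      intro x y hxy
      by_contra h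
      have := hVsep i x y h
      rw [hxy, dist_self] at this
      linarith
    have hcard := card_le_of_separated_of_subset_closedBall (univ.image (V i)) (V j o)
      (r := s * t (F i j)) (R := 2 * t (F i j)) (by positivity) (by positivity) ?_ ?_
    · rw [card_image_of_injective _ hinj, card_univ, Fintype.card_fin,
        finrank_euclideanSpace_fin] at hcard
      have h5 : 1 + 2 * (2 * t (F i j)) / (s * t (F i j)) = 1 + 4 / s := by
        have : t (F i j) ≠ 0 := by positivity
        field_simp
        ring
      rw [h5, hm] at hcard
      have := Nat.lt_floor_add_one ((1 + 4 / s) ^ d)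
      push_cast at hcard
      linarith
    · intro z hz
      obtain ⟨x, -, rfl⟩ := mem_image.1 hz
      have := (hF i j hji.symm x o).2
      change dist (V i x) (V j o) ≤ _ at this
      linarith
    · intro z hz z' hz' hzz
      obtain ⟨x, -, rfl⟩ := mem_image.1 hz
      obtain ⟨y, -, rfl⟩ := mem_image.1 hz'
      exact hfar x y fun h => hzz (by rw [h])
  choose x y hxy hclose using hpair
  let p : Fin (N + 1) → EuclideanSpace ℝ (Fin d) := fun i => V i (x i)
  have hpdist : ∀ i j, i ≠ j → dist (p i) (p j) ∈ Set.Icc (t (F i j)) (t (F i j) + ε') :=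
    fun i j hij => hF i j hij _ _
  have hp : Function.Injective p := by
    intro i j hij
    by_contra h
    have := hVsep' i j (x i) (x j) h
    change 2 ≤ dist (p i) (p j) at this
    rw [hij, dist_self] at this
    linarith
  refine ⟨univ.image p, ⟨?_, ?_⟩, ⟨by omega, ?_⟩, ?_⟩
  · intro a ha b hb hab
    simp only [coe_image, coe_univ, Set.image_univ, Set.mem_range] at ha hb
    obtain ⟨i, rfl⟩ := ha
    obtain ⟨j, rfl⟩ := hb
    have hij : i ≠ j := fun h => hab (by rw [h])
    linarith [(hpdist i j hij).1, hl i j hij]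
  -- The `t i` may repeat or be at most `1`; only values above `1` occur between the chosen points,
  -- and these are padded to `k` distinct ones.
  · obtain ⟨τ, hτ, hτ1, hτt⟩ := exists_strictMono_of_card_le
      ((univ.image t).filter (1 < ·)) (k := k)
      ((card_filter_le _ _).trans (card_image_le.trans (by simp))) (by simp)
    refine ⟨τ, hτ, hτ1, ?_⟩
    intro a ha b hb hab
    simp only [coe_image, coe_univ, Set.image_univ, Set.mem_range] at ha hb
    obtain ⟨i, rfl⟩ := ha
    obtain ⟨j, rfl⟩ := hb
    have hij : i ≠ j := fun h => hab (by rw [h])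
    obtain ⟨l, hll⟩ := hτt (t (F i j)) (by
      simp only [mem_filter, mem_image, mem_univ, true_and, exists_apply_eq_apply]
      linarith [hl i j hij])
    refine ⟨l, ?_⟩
    rw [hll]
    exact ⟨(hpdist i j hij).1, (hpdist i j hij).2.trans (by linarith)⟩
  · intro a ha
    simp only [coe_image, coe_univ, Set.image_univ, Set.mem_range] at ha
    obtain ⟨i, rfl⟩ := ha
    have hδ : 2 ≤ dist (V i (y i)) (p i) := hVsep i _ _ (hxy i).symm
    have hu : V i (y i) - p i ≠ 0 := by
      rw [← norm_ne_zero_iff, ← dist_eq_norm]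
      linarith
    obtain ⟨Λ, hne, hdim, hΛ⟩ := exists_hyperplane hu
    refine ⟨Λ, hne, hdim, ?_⟩
    intro b hb hba
    simp only [coe_image, coe_univ, Set.image_univ, Set.mem_range] at hb
    obtain ⟨j, rfl⟩ := hb
    have hji : j ≠ i := fun h => hba (by rw [h])
    have hlj := hl i j hji.symm
    have h1 := hpdist i j hji.symm
    have h2 : dist (V i (y i)) (p j) ∈ Set.Icc (t (F i j)) (t (F i j) + ε') :=
      hF i j hji.symm _ _
    refine (angleToPlane_le hβ0 hβ1 (sub_ne_zero.2 hba.symm) hu ?_ Λ hΛ).trans (min_le_left _ _)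
    refine abs_inner_le_of_dist_near hε's (by linarith) hδ ?_ (by linarith [h1.1]) ?_
    · exact (hclose i j hji).trans (mul_le_mul_of_nonneg_left h1.1 hs0.le)
    · rw [abs_le]
      constructor <;> linarith [h1.1, h1.2, h2.1, h2.2]
  · rw [card_image_of_injective _ hp, card_univ, Fintype.card_fin]

/-! ### Lower bound: Turán graphs from flat sets -/

theorem ncard_edgeSet_le_of_embedding {V W : Type*} [Finite W] {G : SimpleGraph V}
    {H : SimpleGraph W} (f : V → W) (hf : Function.Injective f)
    (hadj : ∀ v w, G.Adj v w → H.Adj (f v) (f w)) : G.edgeSet.ncard ≤ H.edgeSet.ncard := by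
  let φ : G →g H := ⟨f, hadj _ _⟩
  rw [← Nat.card_coe_set_eq, ← Nat.card_coe_set_eq]
  exact Nat.card_le_card_of_injective φ.mapEdgeSet (SimpleGraph.Hom.mapEdgeSet.injective φ hf)

/-- If `w` is almost orthogonal to `v` and short compared to `R • v`, then `R • v + w` and `R • v`
have nearly the same length. -/
theorem abs_norm_smul_add_sub_le {E : Type*} [NormedAddCommGroup E] [InnerProductSpace ℝ E]
    {v w : E} {R n : ℝ} (hR : 16 * n ^ 2 + 4 ≤ R) (hv : 1 ≤ ‖v‖) (hw : ‖w‖ ≤ 2 * n)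
    (hvw : |inner ℝ v w| ≤ ‖v‖ / 8) : |‖R • v + w‖ - R * ‖v‖| ≤ 1 / 4 := by
  have hR0 : 4 ≤ R := by nlinarith [sq_nonneg n]
  have h1 : ‖R • v + w‖ ^ 2 = (R * ‖v‖) ^ 2 + 2 * (R * inner ℝ v w) + ‖w‖ ^ 2 := by
    rw [norm_add_sq_real, norm_smul, Real.norm_of_nonneg (by linarith), real_inner_smul_left]
  obtain ⟨h2, h3⟩ := abs_le.1 hvw
  have hw2 : ‖w‖ ^ 2 ≤ 4 * n ^ 2 := by nlinarith [norm_nonneg w]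
  have hD : R ≤ R * ‖v‖ := by nlinarith
  have h4 : R * inner ℝ v w ≤ R * ‖v‖ / 8 := by nlinarith
  have h5 : -(R * ‖v‖ / 8) ≤ R * inner ℝ v w := by nlinarith
  have h6 := norm_nonneg (R • v + w)
  -- The squared length differs from `D ^ 2` by at most `D / 4 + 4 * n ^ 2`, hence by at most `D /
  -- 2`, because `16 * n ^ 2 ≤ R ≤ D`.
  set D := R * ‖v‖
  rw [abs_le]
  constructor
  · have : (D - 1 / 4) ^ 2 ≤ ‖R • v + w‖ ^ 2 := by nlinarith [sq_nonneg ‖w‖]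
    have := abs_le_of_sq_le_sq' this h6
    linarith [this.2]
  · have : ‖R • v + w‖ ^ 2 ≤ (D + 1 / 4) ^ 2 := by nlinarith
    have := abs_le_of_sq_le_sq' this (by linarith)
    linarith [this.2]

/-- Replacing the points of a flat nearly `k`-distance set by long segments of equally spaced points
in the normal directions produces a separated set whose distance graph contains a Turán graph. -/
theorem turanNumber_mem_pairCounts {k d N : ℕ} (n : ℕ) (hd : 1 ≤ d) (hN : 1 ≤ N)
    (h : N ∈ flatCards k d (d - 1)) : turanNumber n N ∈ pairCounts k d n 1 := by
  classical
  set R : ℝ := 16 * (n : ℝ) ^ 2 + 4 with hR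
  have hR4 : 4 ≤ R := by rw [hR]; nlinarith [sq_nonneg (n : ℝ)]
  -- Two displacements of size at most `n`, each with inner product at most `2α‖v‖` per unit, add up
  -- to at most `‖v‖ / 8`. The tolerance `1 / (2 * R)` becomes `1 / 2` after scaling, leaving `1 /
  -- 4` on either side of an interval of length `1`.
  have hα : (0 : ℝ) < 1 / (32 * (n + 1)) := by positivity
  obtain ⟨P, ⟨hsep, t, ht, ht1, hdist⟩, ⟨-, hflat⟩, hcard⟩ := h (1 / (2 * R)) (by positivity) _ hα
  have hnormal : ∀ p ∈ P, ∃ u : EuclideanSpace ℝ (Fin d), ‖u‖ = 1 ∧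
      ∀ q ∈ P, q ≠ p → |inner ℝ (p - q) u| ≤ 1 / (16 * (n + 1)) * ‖p - q‖ := by
    intro p hp
    obtain ⟨Λ, -, hdim, hΛ⟩ := hflat p hp
    obtain ⟨u, hu, hperp⟩ := exists_unit_normal hd Λ hdim
    refine ⟨u, hu, fun q hq hqp => ?_⟩
    have hα2 : 1 / (32 * ((n : ℝ) + 1)) ≤ 1 / 2 := by
      apply one_div_le_one_div_of_le (by norm_num)
      have : (0 : ℝ) ≤ n := n.cast_nonneg
      linarith
    refine (abs_inner_le_of_angleToPlane_le hα hα2 hu Λ hperp (hΛ q hq hqp)).trans_eq ?_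
    congr 1
    field_simp
    norm_num
  choose! u hu hnear using hnormal
  let e : Fin N ≃ P := (P.equivFinOfCardEq hcard).symm
  -- The residue mod `N` selects the row, as in `turanGraph`; the quotient is the position along it.
  let r : Fin n → Fin N := fun v => ⟨(v : ℕ) % N, Nat.mod_lt _ hN⟩
  let p : Fin n → EuclideanSpace ℝ (Fin d) := fun v => e (r v)
  have hpP : ∀ v, p v ∈ P := fun v => (e (r v)).2
  have hp_iff : ∀ v w, p v = p w ↔ (v : ℕ) % N = (w : ℕ) % N := by
    intro v w
    simp only [p, r, Subtype.val_inj, EmbeddingLike.apply_eq_iff_eq, Fin.mk.injEq]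
  let b : Fin n → ℝ := fun v => (((v : ℕ) / N : ℕ) : ℝ)
  have hb : ∀ v, |b v| ≤ n := fun v => by
    rw [abs_of_nonneg (Nat.cast_nonneg _)]
    exact Nat.cast_le.2 ((Nat.div_le_self _ _).trans v.2.le)
  let x : Fin n → EuclideanSpace ℝ (Fin d) := fun v => R • p v + b v • u (p v)
  have hfar : ∀ v w, p v ≠ p w → |dist (x v) (x w) - R * dist (p v) (p w)| ≤ 1 / 4 := by
    intro v w hvw
    have hx : x v - x w = R • (p v - p w) + (b v • u (p v) - b w • u (p w)) := by
      simp only [x, smul_sub]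
      abel
    rw [dist_eq_norm, dist_eq_norm, hx]
    have h1 := hnear _ (hpP v) _ (hpP w) hvw.symm
    have h2 : |inner ℝ (p v - p w) (u (p w))| ≤ 1 / (16 * (n + 1)) * ‖p v - p w‖ := by
      have := hnear _ (hpP w) _ (hpP v) hvw
      rwa [← neg_sub, inner_neg_left, abs_neg, norm_neg] at this
    apply abs_norm_smul_add_sub_le (n := n) hR.ge
    · rw [← dist_eq_norm]
      exact hsep (hpP v) (hpP w) hvw
    · refine (norm_sub_le _ _).trans ?_
      rw [norm_smul, norm_smul, hu _ (hpP v), hu _ (hpP w), Real.norm_eq_abs, Real.norm_eq_abs]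
      linarith [hb v, hb w]
    · rw [inner_sub_right, real_inner_smul_right, real_inner_smul_right]
      refine (abs_sub _ _).trans ?_
      rw [abs_mul, abs_mul]
      have h3 : |b v| * |inner ℝ (p v - p w) (u (p v))| ≤
          n * (1 / (16 * (n + 1)) * ‖p v - p w‖) := by gcongr; exact hb v
      have h4 : |b w| * |inner ℝ (p v - p w) (u (p w))| ≤
          n * (1 / (16 * (n + 1)) * ‖p v - p w‖) := by gcongr; exact hb w
      have h5 : n * (1 / (16 * ((n : ℝ) + 1)) * ‖p v - p w‖) ≤ ‖p v - p w‖ / 16 := by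
        have : n * (1 / (16 * ((n : ℝ) + 1)) * ‖p v - p w‖) =
            (n / ((n : ℝ) + 1)) * (‖p v - p w‖ / 16) := by
          field_simp
        rw [this]
        apply mul_le_of_le_one_left (by positivity)
        rw [div_le_one (by positivity)]
        linarith
      linarith
  have hpair : ∀ v w, p v ≠ p w →
      ∃ i, dist (x v) (x w) ∈ Set.Icc (R * t i - 1 / 4) (R * t i - 1 / 4 + 1) := by
    intro v w hvw
    obtain ⟨i, hi1, hi2⟩ := hdist (hpP v) (hpP w) hvw
    obtain ⟨h1, h2⟩ := abs_le.1 (hfar v w hvw)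
    have h3 : R * t i ≤ R * dist (p v) (p w) := by gcongr
    have h4 : R * dist (p v) (p w) ≤ R * (t i + 1 / (2 * R)) := by gcongr
    have h5 : R * (t i + 1 / (2 * R)) = R * t i + 1 / 2 := by field_simp
    exact ⟨i, by linarith, by linarith⟩
  have hRt : ∀ i, 1 ≤ R * t i - 1 / 4 := fun i => by nlinarith [ht1 i]
  have hxsep : ∀ v w, v ≠ w → 1 ≤ dist (x v) (x w) := by
    intro v w hvw
    by_cases hpvw : p v = p w
    · have hx : x v - x w = (b v - b w) • u (p w) := by
        simp only [x, hpvw, sub_smul]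
        abel
      rw [dist_eq_norm, hx, norm_smul, hu _ (hpP w), mul_one]
      have hne : (v : ℕ) / N ≠ (w : ℕ) / N := by
        intro hdiv
        apply hvw
        ext
        rw [← Nat.mod_add_div (v : ℕ) N, ← Nat.mod_add_div (w : ℕ) N, hdiv, (hp_iff v w).1 hpvw]
      exact Nat.pairwise_one_le_dist hne
    · obtain ⟨i, hi, -⟩ := hpair v w hpvw
      linarith [hRt i]
  have hxinj : Function.Injective x := by
    intro v w hvw
    by_contra hne
    have := hxsep v w hne
    rw [hvw, dist_self] at this
    linarith
  refine ⟨univ.image x, fun i => R * t i - 1 / 4, ?_, ?_, ?_, hRt, ?_⟩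
  · intro y hy z hz hyz
    simp only [coe_image, coe_univ, Set.image_univ, Set.mem_range] at hy hz
    obtain ⟨v, rfl⟩ := hy
    obtain ⟨w, rfl⟩ := hz
    exact hxsep v w fun h => hyz (by rw [h])
  · rw [card_image_of_injective _ hxinj, card_univ, Fintype.card_fin]
  · intro i j hij
    have := ht.monotone hij
    simp only
    gcongr
  · rw [turanNumber, ← Set.ncard_coe_finset, SimpleGraph.coe_edgeFinset]
    refine ncard_edgeSet_le_of_embedding
      (fun v => ⟨x v, mem_image_of_mem x (mem_univ v)⟩) (fun v w h => ?_) fun v w hvw => ?_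
    · exact hxinj (congrArg Subtype.val h)
    · have hne : p v ≠ p w := fun h => hvw ((hp_iff v w).1 h)
      refine ⟨fun h => hne ?_, hpair v w hne⟩
      rw [hxinj (congrArg Subtype.val h)]

/-- The main term of the exact edge count is a natural-number quotient: rounding loses at most `1`,
and replacing `n % r` by `r` loses at most `r ^ 2`. -/
theorem le_turanNumber (n r : ℕ) (hr : 1 ≤ r) :
    (1 - 1 / (r : ℝ)) * ((n : ℝ) ^ 2 / 2) - ((r : ℝ) ^ 2 + 1) ≤ turanNumber n r := by
  have hr' : (1 : ℝ) ≤ r := by exact_mod_cast hr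
  have hmod : ((n % r : ℕ) : ℝ) ≤ r := by exact_mod_cast (Nat.mod_lt n hr).le
  have hle : n % r ≤ n := Nat.mod_le _ _
  have h1 : (n ^ 2 - (n % r) ^ 2) * (r - 1) / (2 * r) ≤ turanNumber n r := by
    rw [turanNumber, SimpleGraph.card_edgeFinset_turanGraph]
    exact Nat.le_add_right _ _
  have h2 : ((n ^ 2 - (n % r) ^ 2) * (r - 1) : ℕ) <
      2 * r * (((n ^ 2 - (n % r) ^ 2) * (r - 1) / (2 * r)) + 1) :=
    Nat.lt_mul_div_succ _ (by omega)
  have h3 : ((n ^ 2 - (n % r) ^ 2) * (r - 1) : ℕ) ≤ 2 * r * (turanNumber n r + 1) :=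
    h2.le.trans (by gcongr)
  have h4 : (((n : ℝ) ^ 2 - ((n % r : ℕ) : ℝ) ^ 2) * (r - 1)) ≤ 2 * r * (turanNumber n r + 1) := by
    have := (Nat.cast_le (α := ℝ)).2 h3
    rw [Nat.cast_mul, Nat.cast_sub (by gcongr), Nat.cast_sub hr] at this
    push_cast at this ⊢
    exact this
  have h5 : ((n : ℝ) ^ 2 - (r : ℝ) ^ 2) * (r - 1) ≤ 2 * r * (turanNumber n r + 1) := by
    refine le_trans ?_ h4
    gcongr
  have h6 : (1 - 1 / (r : ℝ)) * ((n : ℝ) ^ 2 / 2) =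
      (((n : ℝ) ^ 2 - (r : ℝ) ^ 2) * (r - 1) + (r : ℝ) ^ 2 * (r - 1)) / (2 * r) := by
    field_simp
    ring
  rw [h6, sub_le_iff_le_add, div_le_iff₀ (by positivity)]
  nlinarith [sq_nonneg (r : ℝ), mul_nonneg (sq_nonneg (r : ℝ)) (by linarith : (0 : ℝ) ≤ r)]

/-! ### Upper bound: far dense samples and rescaling -/

theorem maxPairs_mono {k d n : ℕ} (hd : 1 ≤ d) {L L' : ℝ} (h : L ≤ L') :
    maxPairs k d n L ≤ maxPairs k d n L' := by
  apply (isGreatest_maxPairs k d n hd L').2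
  obtain ⟨S, t, hS, hn, ht, ht1, hM⟩ := (isGreatest_maxPairs k d n hd L).1
  refine ⟨S, t, hS, hn, ht, ht1, hM.trans ?_⟩
  refine ncard_edgeSet_le_of_embedding id Function.injective_id fun p q hpq => ⟨hpq.1, ?_⟩
  obtain ⟨i, hi⟩ := hpq.2
  exact ⟨i, hi.1, hi.2.trans (by linarith)⟩

theorem two_mul_ncard_edgeSet {V : Type*} (S : Finset V) (H : SimpleGraph S) (G : SimpleGraph V)
    [DecidableRel G.Adj] (h : ∀ p q : S, H.Adj p q ↔ G.Adj p q) :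
    2 * (H.edgeSet.ncard : ℝ) = ∑ p ∈ S, ∑ q ∈ S, if G.Adj p q then (1 : ℝ) else 0 := by
  classical
  rw [← SimpleGraph.coe_edgeFinset, Set.ncard_coe_finset]
  have h1 := H.sum_degrees_eq_twice_card_edges
  have h2 : (2 * (#H.edgeFinset : ℝ)) = ∑ v, (H.degree v : ℝ) := by
    exact_mod_cast h1.symm
  rw [h2, ← Finset.sum_coe_sort S]
  refine Finset.sum_congr rfl fun p _ => ?_
  rw [← Finset.sum_coe_sort S, ← SimpleGraph.card_neighborFinset_eq_degree,
    SimpleGraph.neighborFinset_eq_filter, Finset.sum_boole]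
  simp_rw [h]

theorem card_filter_dist_lt_le {d : ℕ} {S : Finset (EuclideanSpace ℝ (Fin d))}
    (hS : Separated (S : Set (EuclideanSpace ℝ (Fin d)))) (p : EuclideanSpace ℝ (Fin d)) {ρ : ℝ}
    (hρ : 1 ≤ ρ) : ((S.filter fun q => dist p q < ρ).card : ℝ) ≤ (3 * ρ) ^ d := by
  have h := card_le_of_separated_of_subset_closedBall (S.filter fun q => dist p q < ρ) p one_pos
    (by linarith : 0 ≤ ρ) (fun q hq => by rw [dist_comm]; exact (mem_filter.1 hq).2.le)
    (fun q hq q' hq' hne => hS (mem_filter.1 hq).1 (mem_filter.1 hq').1 hne)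
  rw [finrank_euclideanSpace_fin] at h
  refine h.trans ?_
  gcongr
  linarith

/-- A separated set of `n` points whose graph `G` is dense contains `m` points that span a dense
subgraph and whose distances are at least `δ n ^ (1 / d)`, i.e. `δ x` with `x ^ d = n`. -/
theorem exists_far_dense_subset {d m : ℕ} {S : Finset (EuclideanSpace ℝ (Fin d))}
    (hS : Separated (S : Set (EuclideanSpace ℝ (Fin d))))
    (G : SimpleGraph (EuclideanSpace ℝ (Fin d))) [DecidableRel G.Adj] {A δ x γ : ℝ} (hγ : 0 < γ)
    (hA : 0 ≤ A) (hm : 2 ≤ m) (hmS : m ≤ S.card) (hδ : m ^ 2 * (3 * δ) ^ d ≤ γ / 2)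
    (hx : x ^ d = S.card) (hδx : 1 ≤ δ * x)
    (hG : (A + γ) * (S.card : ℝ) ^ 2 ≤ ∑ p ∈ S, ∑ q ∈ S, if G.Adj p q then (1 : ℝ) else 0) :
    ∃ W ⊆ S, W.card = m ∧ (∀ p ∈ W, ∀ q ∈ W, p ≠ q → δ * x ≤ dist p q) ∧
      (A + γ / 2) * (m * (m - 1)) ≤ ∑ p ∈ W, ∑ q ∈ W, if G.Adj p q then (1 : ℝ) else 0 := by
  classical
  set ρ := δ * x with hρ
  let a : EuclideanSpace ℝ (Fin d) → EuclideanSpace ℝ (Fin d) → ℝ :=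
    fun p q => if G.Adj p q then 1 else 0
  let b : EuclideanSpace ℝ (Fin d) → EuclideanSpace ℝ (Fin d) → ℝ :=
    fun p q => if p ≠ q ∧ dist p q < ρ then 1 else 0
  have ha1 : ∀ p q, a p q ≤ 1 := fun p q => by simp only [a]; split_ifs <;> norm_num
  have hb0 : ∀ p q, 0 ≤ b p q := fun p q => by simp only [b]; split_ifs <;> norm_num
  have hsplit : ∀ U : Finset (EuclideanSpace ℝ (Fin d)),
      ∑ p ∈ U, ∑ q ∈ U, (a p q - (m : ℝ) ^ 2 * b p q) =
        ∑ p ∈ U, ∑ q ∈ U, a p q - (m : ℝ) ^ 2 * ∑ p ∈ U, ∑ q ∈ U, b p q := fun U => by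
    simp only [Finset.sum_sub_distrib, Finset.mul_sum]
  have hclose : ∑ p ∈ S, ∑ q ∈ S, b p q ≤ S.card * ((3 * δ) ^ d * S.card) := by
    rw [← nsmul_eq_mul]
    refine Finset.sum_le_card_nsmul _ _ _ fun p _ => ?_
    rw [← hx, ← mul_pow, mul_assoc, ← hρ]
    refine le_trans ?_ (card_filter_dist_lt_le hS p hδx)
    simp only [b]
    rw [Finset.sum_boole]
    exact Nat.cast_le.2 (card_le_card fun q hq =>
      mem_filter.2 ⟨(mem_filter.1 hq).1, (mem_filter.1 hq).2.2⟩)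
  -- Close pairs are penalised by `m ^ 2`. In `S` the total penalty is at most `γ / 2 * S.card ^ 2`;
  -- in `W` a single close pair would cancel all edges and make the weight nonpositive.
  obtain ⟨W, hWS, hWm, hW⟩ := exists_subset_sum_ge (fun p q => a p q - (m : ℝ) ^ 2 * b p q)
    (fun p => by simp [a, b]) (A + γ / 2) (by omega : 1 ≤ m) S.card hmS S rfl (by
      rw [hsplit]
      have h1 : (m : ℝ) ^ 2 * ∑ p ∈ S, ∑ q ∈ S, b p q ≤ γ / 2 * (S.card : ℝ) ^ 2 := by
        calc _ ≤ (m : ℝ) ^ 2 * (S.card * ((3 * δ) ^ d * S.card)) := by gcongr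
          _ = (m ^ 2 * (3 * δ) ^ d) * (S.card : ℝ) ^ 2 := by ring
          _ ≤ _ := by gcongr
      have h2 : 0 ≤ (A + γ / 2) * (S.card : ℝ) := by positivity
      change (A + γ) * (S.card : ℝ) ^ 2 ≤ ∑ p ∈ S, ∑ q ∈ S, a p q at hG
      nlinarith)
  rw [hsplit] at hW
  have hm' : (2 : ℝ) ≤ m := by exact_mod_cast hm
  have hpos : 0 < (A + γ / 2) * ((m : ℝ) * (m - 1)) := by
    have : (0 : ℝ) < m - 1 := by linarith
    positivity
  have hbW : 0 ≤ ∑ p ∈ W, ∑ q ∈ W, b p q :=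
    Finset.sum_nonneg fun p _ => Finset.sum_nonneg fun q _ => hb0 p q
  refine ⟨W, hWS, hWm, fun p hp q hq hpq => ?_, ?_⟩
  · by_contra! hlt
    have h1 : 1 ≤ ∑ p ∈ W, ∑ q ∈ W, b p q := by
      have h2 : b p q = 1 := if_pos ⟨hpq, hlt⟩
      have h3 := Finset.single_le_sum (f := fun q => b p q) (fun q _ => hb0 p q) hq
      have h4 := Finset.single_le_sum (f := fun p => ∑ q ∈ W, b p q)
        (fun p _ => Finset.sum_nonneg fun q _ => hb0 p q) hp
      linarith
    have h2 : ∑ p ∈ W, ∑ q ∈ W, a p q ≤ (m : ℝ) ^ 2 := by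
      calc _ ≤ ∑ p ∈ W, ∑ q ∈ W, (1 : ℝ) := by gcongr; exact ha1 _ _
        _ = _ := by simp [hWm, sq]
    nlinarith [sq_nonneg (m : ℝ)]
  · have : 0 ≤ (m : ℝ) ^ 2 * ∑ p ∈ W, ∑ q ∈ W, b p q := by positivity
    change _ ≤ ∑ p ∈ W, ∑ q ∈ W, a p q
    linarith

theorem exists_maxPairs_le {k d N : ℕ} (hk : 1 ≤ k) (hd : 2 ≤ d) (hN : 1 ≤ N)
    (h : N + 1 ∉ flatCards k d (d - 1)) {γ : ℝ} (hγ : 0 < γ) :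
    ∃ c : ℝ, 0 < c ∧ ∃ n₀ : ℕ, ∀ n : ℕ, n₀ ≤ n →
      (maxPairs k d n (c * (n : ℝ) ^ (1 / (d : ℝ))) : ℝ) ≤
        (1 - 1 / (N : ℝ) + γ) * ((n : ℝ) ^ 2 / 2) := by
  classical
  simp only [flatCards, Set.mem_ofPred_eq, not_forall] at h
  obtain ⟨ε, hε, α, hα, hP⟩ := h
  obtain ⟨M, ε', hε', hM⟩ := exists_flat_of_blowup k d N hk hd hN hε hα
  obtain ⟨m₀, hm₀⟩ := exists_blowup_of_density (by positivity : 0 < γ / 4) N M hN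
  -- For such `m`, replacing `m * (m - 1)` by `m ^ 2` costs at most `γ / 4` in density.
  obtain ⟨m₁, hm₁⟩ := exists_nat_gt (4 / γ + 2)
  set m := max m₀ m₁ with hm
  have hmγ : 4 / γ + 2 ≤ (m : ℝ) := hm₁.le.trans (by exact_mod_cast le_max_right _ _)
  have hm2' : (2 : ℝ) ≤ m := by
    have : 0 < 4 / γ := by positivity
    linarith
  have hm2 : 2 ≤ m := by exact_mod_cast hm2'
  have hN' : (1 : ℝ) ≤ N := by exact_mod_cast hN
  set A : ℝ := 1 - 1 / (N : ℝ) with hA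
  have hA0 : 0 ≤ A := by
    have : 1 / (N : ℝ) ≤ 1 := by rw [div_le_one (by positivity)]; exact hN'
    linarith
  have hA1 : A ≤ 1 := by
    have : 0 ≤ 1 / (N : ℝ) := by positivity
    linarith
  have hdens : (A + γ / 4) * (m : ℝ) ^ 2 ≤ (A + γ / 2) * (m * (m - 1)) := by
    have h1 : 4 + 2 * γ ≤ γ * m := by
      have := mul_le_mul_of_nonneg_left hmγ hγ.le
      rw [mul_add, mul_div_cancel₀ _ hγ.ne'] at this
      linarith
    have h2 : (A + γ / 2) ≤ γ / 4 * m := by linarith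
    nlinarith
  set δ : ℝ := min (1 / 3) (γ / (6 * m ^ 2)) with hδ
  have hδ0 : 0 < δ := by positivity
  have hδγ : (m : ℝ) ^ 2 * (3 * δ) ^ d ≤ γ / 2 := by
    have h1 : (3 * δ) ^ d ≤ 3 * δ := pow_le_of_le_one (by positivity)
      (by linarith [min_le_left (1 / 3) (γ / (6 * (m : ℝ) ^ 2))]) (by omega)
    calc (m : ℝ) ^ 2 * (3 * δ) ^ d ≤ (m : ℝ) ^ 2 * (3 * (γ / (6 * m ^ 2))) := by
          gcongr
          exact h1.trans (by gcongr; exact min_le_right _ _)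
      _ = γ / 2 := by field_simp; norm_num
  obtain ⟨n₁, hn₁⟩ := exists_nat_gt ((1 / δ) ^ d)
  -- Sampled points are at least `ρ = δ * n ^ (1 / d)` apart. Scaling by `2 / ρ` makes them
  -- `2`-separated and the intervals exactly `ε'` long.
  refine ⟨ε' * δ / 2, by positivity, max n₁ m, fun n hn => ?_⟩
  have hd0 : (d : ℝ) ≠ 0 := by positivity
  set x : ℝ := (n : ℝ) ^ (1 / (d : ℝ)) with hx
  have hx0 : 0 ≤ x := by positivity
  have hxd : x ^ d = n := by
    rw [hx, ← Real.rpow_natCast, ← Real.rpow_mul n.cast_nonneg, one_div_mul_cancel hd0,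
      Real.rpow_one]
  have hδx : 1 ≤ δ * x := by
    have h1 : (1 / δ) ^ d ≤ x ^ d := by
      rw [hxd]
      exact hn₁.le.trans (by exact_mod_cast (le_max_left _ _).trans hn)
    have h2 : 1 / δ ≤ x := le_of_pow_le_pow_left₀ (by omega) hx0 h1
    rwa [div_le_iff₀' hδ0] at h2
  obtain ⟨S, t, hS, hSn, -, ht1, hE⟩ :=
    (isGreatest_maxPairs k d n (by omega) (ε' * δ / 2 * x)).1
  set G : SimpleGraph (EuclideanSpace ℝ (Fin d)) :=
    { Adj := fun p q => p ≠ q ∧ ∃ i, dist p q ∈ Set.Icc (t i) (t i + ε' * δ / 2 * x)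
      symm := ⟨fun p q h => ⟨h.1.symm, by simpa only [dist_comm] using h.2⟩⟩
      loopless := ⟨fun _ h => h.1 rfl⟩ } with hG
  have hcount := two_mul_ncard_edgeSet S (distGraph S t (ε' * δ / 2 * x)) G fun p q => by
    simp only [distGraph, hG, ne_eq, Subtype.ext_iff]
  have hE' : (maxPairs k d n (ε' * δ / 2 * x) : ℝ) ≤
      (distGraph S t (ε' * δ / 2 * x)).edgeSet.ncard := by exact_mod_cast hE
  by_contra! hlt
  obtain ⟨W, hWS, hWm, hWfar, hWdens⟩ := exists_far_dense_subset (m := m) hS G hγ hA0 hm2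
    (by rw [hSn]; exact (le_max_right _ _).trans hn) hδγ (by rw [hSn]; exact hxd) hδx
    (by rw [hSn]; linarith)
  obtain ⟨f, hf, hfW, hfG⟩ := hm₀ _ G W (by rw [hWm]; exact le_max_left _ _)
    (by rw [hWm]; exact hdens.trans hWdens)
  set ρ := δ * x with hρ
  have hρ0 : 0 < ρ := by linarith
  have hscale : ∀ y z : EuclideanSpace ℝ (Fin d),
      dist ((2 / ρ) • y) ((2 / ρ) • z) = 2 / ρ * dist y z := fun y z => by
    rw [dist_smul₀, Real.norm_of_nonneg (by positivity)]
  obtain ⟨P, hP1, hP2, hP3⟩ := hM (fun i => 2 / ρ * t i) (fun y => (2 / ρ) • f y)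
    (fun y z hyz => by
      have := hWfar _ (hfW y) _ (hfW z) (hf.ne hyz)
      rw [hscale, div_mul_eq_mul_div, le_div_iff₀ hρ0]
      linarith)
    (fun y z hyz => by
      obtain ⟨-, i, hi1, hi2⟩ := hfG y z hyz
      refine ⟨i, ?_, ?_⟩
      · rw [hscale]
        gcongr
      · rw [hscale]
        have : 2 / ρ * t i + ε' = 2 / ρ * (t i + ε' * δ / 2 * x) := by
          have h1 : ε' * δ / 2 * x = ε' * ρ / 2 := by rw [hρ]; ring
          rw [h1]
          field_simp
        rw [this]
        gcongr)
  exact hP ⟨P, hP1, hP2, hP3⟩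

end NearlyDist

/-! ### Assembling the theorem -/

open NearlyDist in
theorem theorem2p3 (d k : ℕ) (hd : 2 ≤ d) (hk : 1 ≤ k) :
    -- the maximum defining `N_k(d)` exists
    IsGreatest (flatCards k d (d - 1)) (flatNumber k d) ∧
    -- the lower bound by the Turán number, which is `(1 - 1 / N_k(d)) n² / 2 + O(1)`
    (∃ C : ℝ, ∀ n : ℕ,
      (1 - 1 / (flatNumber k d : ℝ)) * ((n : ℝ) ^ 2 / 2) - C ≤ turanNumber n (flatNumber k d) ∧
      turanNumber n (flatNumber k d) ≤ maxPairs k d n 1) ∧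
    -- the asymptotics for intervals of length `1`
    (∀ γ : ℝ, 0 < γ → ∃ n₀ : ℕ, ∀ n : ℕ, n₀ ≤ n →
      (1 - 1 / (flatNumber k d : ℝ) - γ) * ((n : ℝ) ^ 2 / 2) ≤ maxPairs k d n 1 ∧
      (maxPairs k d n 1 : ℝ) ≤ (1 - 1 / (flatNumber k d : ℝ) + γ) * ((n : ℝ) ^ 2 / 2)) ∧
    -- the asymptotics for intervals of length `c n^(1/d)`
    (∀ γ : ℝ, 0 < γ → ∃ c : ℝ, 0 < c ∧ ∃ n₀ : ℕ, ∀ n : ℕ, n₀ ≤ n →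
      (1 - 1 / (flatNumber k d : ℝ) - γ) * ((n : ℝ) ^ 2 / 2) ≤
        maxPairs k d n (c * (n : ℝ) ^ (1 / (d : ℝ))) ∧
      (maxPairs k d n (c * (n : ℝ) ^ (1 / (d : ℝ))) : ℝ) ≤
        (1 - 1 / (flatNumber k d : ℝ) + γ) * ((n : ℝ) ^ 2 / 2)) := by
  have hgreatest := isGreatest_flatNumber k d hd hk
  set N := flatNumber k d with hNdef
  have hN : 1 ≤ N := hgreatest.2 (one_mem_flatCards k d hd)
  have hN1 : N + 1 ∉ flatCards k d (d - 1) := fun h => by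
    have := hgreatest.2 h
    omega
  have hturan : ∀ n, turanNumber n N ≤ maxPairs k d n 1 := fun n =>
    (isGreatest_maxPairs k d n (by omega) 1).2
      (turanNumber_mem_pairCounts n (by omega) hN hgreatest.1)
  have hlower : ∀ γ : ℝ, 0 < γ → ∃ n₀ : ℕ, ∀ n : ℕ, n₀ ≤ n →
      (1 - 1 / (N : ℝ) - γ) * ((n : ℝ) ^ 2 / 2) ≤ maxPairs k d n 1 := by
    intro γ hγ
    obtain ⟨n₀, hn₀⟩ := exists_nat_gt (2 * ((N : ℝ) ^ 2 + 1) / γ + 1)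
    refine ⟨n₀, fun n hn => ?_⟩
    have h1 := le_turanNumber n N hN
    have h2 : (turanNumber n N : ℝ) ≤ maxPairs k d n 1 := by exact_mod_cast hturan n
    have h3 : 2 * ((N : ℝ) ^ 2 + 1) / γ + 1 < n := hn₀.trans_le (by exact_mod_cast hn)
    have h4 : 0 ≤ 2 * ((N : ℝ) ^ 2 + 1) / γ := by positivity
    have h5 : 2 * ((N : ℝ) ^ 2 + 1) ≤ γ * (n : ℝ) ^ 2 := by
      rw [← div_le_iff₀' hγ]
      nlinarith
    nlinarith
  -- a fixed `c n ^ (1 / d)` eventually exceeds `1`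
  have hlong : ∀ c : ℝ, 0 < c → ∃ n₀ : ℕ, ∀ n : ℕ, n₀ ≤ n →
      1 ≤ c * (n : ℝ) ^ (1 / (d : ℝ)) := by
    intro c hc
    have h1 : Filter.Tendsto (fun n : ℕ => c * (n : ℝ) ^ (1 / (d : ℝ))) Filter.atTop
        Filter.atTop :=
      ((tendsto_rpow_atTop (by positivity)).comp tendsto_natCast_atTop_atTop).const_mul_atTop hc
    exact Filter.eventually_atTop.1 (h1.eventually_ge_atTop 1)
  refine ⟨hgreatest, ⟨(N : ℝ) ^ 2 + 1, fun n => ⟨le_turanNumber n N hN, hturan n⟩⟩, ?_, ?_⟩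
  · intro γ hγ
    obtain ⟨c, hc, n₁, hn₁⟩ := exists_maxPairs_le hk hd hN hN1 hγ
    obtain ⟨n₂, hn₂⟩ := hlower γ hγ
    obtain ⟨n₃, hn₃⟩ := hlong c hc
    refine ⟨max n₁ (max n₂ n₃), fun n hn => ?_⟩
    simp only [max_le_iff] at hn
    refine ⟨hn₂ n hn.2.1, le_trans ?_ (hn₁ n hn.1)⟩
    exact_mod_cast maxPairs_mono (by omega) (hn₃ n hn.2.2)
  · intro γ hγ
    obtain ⟨c, hc, n₁, hn₁⟩ := exists_maxPairs_le hk hd hN hN1 hγ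
    obtain ⟨n₂, hn₂⟩ := hlower γ hγ
    obtain ⟨n₃, hn₃⟩ := hlong c hc
    refine ⟨c, hc, max n₁ (max n₂ n₃), fun n hn => ?_⟩
    simp only [max_le_iff] at hn
    refine ⟨(hn₂ n hn.2.1).trans ?_, hn₁ n hn.1⟩
    exact_mod_cast maxPairs_mono (by omega) (hn₃ n hn.2.2)
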